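/- Let $d\ge 1$ and let $G=(V,E)$ be a finite simple graph. A realization (framework) of $G$ in $\mathbb{R}^d$ is a pair $(G,p)$ with $p:V\to\mathbb{R}^d$; it is generic if its $d|V|$ vertex coordinates are algebraically independent over $\mathbb{Q}$. Two realizations $(G,p)$ and $(G,q)$ are equivalent if $\|p(x)-p(y)\|=\|q(x)-q(y)\|$ for all $xy\in E$, and congruent if this holds for all $x,y\in V$. The framework $(G,p)$ is rigid if there is $\varepsilon>0$ such that every $(G,q)$ that is equivalent to $(G,p)$ and satisfies $\|p(x)-q(x)\|<\varepsilon$ for all $x\in V$ is congruent to $(G,p)$; a graph is rigid in $\mathbb{R}^d$ if each of its generic realizations in $\mathbb{R}^d$ is rigid. For $u,v\in V$, the pair $\{u,v\}$ is weakly globally linked in $G$ in $\mathbb{R}^d$ if there is a generic realization $(G,p)$ in $\mathbb{R}^d$ such that $\|p(u)-p(v)\|=\|q(u)-q(v)\|$ for every realization $(G,q)$ in $\mathbb{R}^d$ equivalent to $(G,p)$. For $X\subseteq V$, the induced subgraph $G[X]$ is $(u,v)$-rigid if $u,v\in X$ and $G[X]$ is rigid in $\mathbb{R}^d$, and $G/X$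 denotes the simple graph obtained from $G$ by identifying the vertices of $X$ and removing the resulting loops and parallel copies of edges. Let $u,v\in V$ and let $V_0\subseteq V$ be such that $G[V_0]$ is $(u,v)$-rigid in $\mathbb{R}^d$, and let $V_1$ be the vertex set of a connected component of $G-V_0$. Then $\{u,v\}$ is weakly globally linked in $G$ in $\mathbb{R}^d$ if and only if $\{u,v\}$ is weakly globally linked in $G/V_1$ in $\mathbb{R}^d$. -/

import Mathlib

/-! A realization of a graph on `V` in `ℝ^d` is a map `p : V → EuclideanSpace ℝ (Fin d)`. -/

namespace Rigidity

/-- The frameworks `(G, p)` and `(G, q)` are equivalent: corresponding edge lengths agree. -/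
def Equivalent {V : Type*} {d : ℕ} (G : SimpleGraph V) (p q : V → EuclideanSpace ℝ (Fin d)) :
    Prop :=
  ∀ x y : V, G.Adj x y → ‖p x - p y‖ = ‖q x - q y‖

/-- `p` and `q` are congruent: all pairwise distances agree. -/
def Congruent {V : Type*} {d : ℕ} (p q : V → EuclideanSpace ℝ (Fin d)) : Prop :=
  ∀ x y : V, ‖p x - p y‖ = ‖q x - q y‖

/-- `p` is generic: its `d |V|` vertex coordinates are algebraically independent over `ℚ`. -/
def Generic {V : Type*} {d : ℕ} (p : V → EuclideanSpace ℝ (Fin d)) : Prop :=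
  AlgebraicIndependent ℚ (fun i : V × Fin d => p i.1 i.2)

/-- The framework `(G, p)` is rigid: every equivalent framework that is close enough to it is
congruent to it. -/
def RigidFramework {V : Type*} {d : ℕ} (G : SimpleGraph V) (p : V → EuclideanSpace ℝ (Fin d)) :
    Prop :=
  ∃ ε : ℝ, 0 < ε ∧ ∀ q : V → EuclideanSpace ℝ (Fin d),
    Equivalent G p q → (∀ x, ‖p x - q x‖ < ε) → Congruent p q

/-- The graph `G` is rigid in `ℝ^d`: every generic realization of `G` in `ℝ^d` is rigid. -/
def RigidGraph {V : Type*} (d : ℕ) (G : SimpleGraph V) : Prop :=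
  ∀ p : V → EuclideanSpace ℝ (Fin d), Generic p → RigidFramework G p

/-- The induced subgraph `G[X]` is `(u, v)`-rigid in `ℝ^d`. -/
def PairRigid {V : Type*} (d : ℕ) (G : SimpleGraph V) (u v : V) (X : Set V) : Prop :=
  RigidGraph d (G.induce X) ∧ u ∈ X ∧ v ∈ X

/-- `{u, v}` is globally linked in the framework `(G, p)`. -/
def GloballyLinked {V : Type*} {d : ℕ} (G : SimpleGraph V) (p : V → EuclideanSpace ℝ (Fin d))
    (u v : V) : Prop :=
  ∀ q : V → EuclideanSpace ℝ (Fin d), Equivalent G p q → ‖p u - p v‖ = ‖q u - q v‖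

/-- `{u, v}` is weakly globally linked in the graph `G` in `ℝ^d`: it is globally linked in some
generic realization of `G`. -/
def WeaklyGloballyLinked {V : Type*} (d : ℕ) (G : SimpleGraph V) (u v : V) : Prop :=
  ∃ p : V → EuclideanSpace ℝ (Fin d), Generic p ∧ GloballyLinked G p u v

/-- The equivalence relation on `V` that identifies all elements of `S` with each other. -/
def contractSetoid {V : Type*} (S : Set V) : Setoid V where
  r x y := x = y ∨ (x ∈ S ∧ y ∈ S)
  iseqv :=
    { refl := fun _ => Or.inl rfl
      symm := fun h => h.elim (fun e => Or.inl e.symm) (fun e => Or.inr ⟨e.2, e.1⟩)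
      trans := by
        rintro x y z (rfl | ⟨hx, hy⟩) (rfl | ⟨hy', hz⟩)
        · exact Or.inl rfl
        · exact Or.inr ⟨hy', hz⟩
        · exact Or.inr ⟨hx, hy⟩
        · exact Or.inr ⟨hx, hz⟩ }

/-- The vertex set of `G / S`. -/
abbrev ContractVertex {V : Type*} (S : Set V) : Type _ := Quotient (contractSetoid S)

/-- The vertex of `G / S` that arises from the vertex `x` of `G`. -/
def toContract {V : Type*} (S : Set V) (x : V) : ContractVertex S :=
  Quotient.mk (contractSetoid S) x

/-- The contraction `G / S`: the vertices of `S` are identified, and loops and parallel edges are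
removed. -/
def contract {V : Type*} (G : SimpleGraph V) (S : Set V) : SimpleGraph (ContractVertex S) :=
  G.map (toContract S)

/-- `S` is the vertex set of a connected component of `G - X`. -/
def IsComponentOfDelete {V : Type*} (G : SimpleGraph V) (X S : Set V) : Prop :=
  ∃ C : (G.induce Xᶜ).ConnectedComponent, S = Subtype.val '' C.supp

end Rigidity

/-!
A generic point is a regular point of every polynomial map over `ℚ`: a polynomial that is locally
constant on the fibre through such a point is algebraic over the components of the map, and hence
takes only finitely many values on the whole fibre. Thus the distances in a generic rigid framework
have only finitely many values over all equivalent frameworks.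

If `u, v` are globally linked in `(G, p)`, place the contracted vertex at a point whose distances to
the neighbours of `V₁` in `V₀` determine the distances among these neighbours; this is possible,
with generic coordinates, because only finitely many values of those distances are at stake. In
every framework equivalent to the contracted one, the neighbours of `V₁` then have their original
mutual distances, so an isometry puts `V₁` back in.

Conversely, a framework of `G / V₁` in which `u, v` are globally linked gives a realization `p` of
`G` that collapses `V₁` to a point and in which `u, v` are globally linked. For generic `p'` near
`p` that agree with `p` off `V₁`, compactness forces the distance of `u` and `v` in every framework
equivalent to `(G, p')` to be close to its value in `p`. Since it takes only finitely many values,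
it equals that value.
-/

namespace Rigidity

open MvPolynomial Topology Filter

section Derivation

theorem exists_aeval_eq_zero_and_aeval_derivative_ne_zero {R A : Type*} [CommRing R] [IsDomain R]
    [CharZero R] [CommRing A] [Algebra R A] [FaithfulSMul R A] {a : A} (ha : IsAlgebraic R a) :
    ∃ P : Polynomial R, Polynomial.aeval a P = 0 ∧
      Polynomial.aeval a (Polynomial.derivative P) ≠ 0 := by
  obtain ⟨P, ⟨hP₀, hPa⟩, hmin⟩ := exists_minimalFor_of_wellFoundedLT
    (fun P : Polynomial R => P ≠ 0 ∧ Polynomial.aeval a P = 0) Polynomial.natDegree ha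
  have hdeg : P.natDegree ≠ 0 := fun hdeg => hP₀ <| by
    rw [Polynomial.eq_C_of_natDegree_eq_zero hdeg] at hPa ⊢
    simpa using hPa
  refine ⟨P, hPa, fun hder => (Polynomial.natDegree_derivative_lt hdeg).not_ge ?_⟩
  exact hmin ⟨fun h => hdeg (Polynomial.derivative_eq_zero.1 h), hder⟩
    (Polynomial.natDegree_derivative_lt hdeg).le

theorem derivation_eq_zero_of_isAlgebraic {R A M : Type*} [CommRing R] [IsDomain R] [CharZero R]
    [CommRing A] [IsDomain A] [Algebra R A] [FaithfulSMul R A] [AddCommGroup M] [Module A M]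
    [Module.IsTorsionFree A M] [Module R M] (D : Derivation R A M) {a : A}
    (ha : IsAlgebraic R a) : D a = 0 := by
  obtain ⟨P, hP, hP'⟩ := exists_aeval_eq_zero_and_aeval_derivative_ne_zero ha
  have h := D.map_aeval P a
  rw [hP, map_zero] at h
  exact (smul_eq_zero.1 h.symm).resolve_left hP'

end Derivation

section Fiber

/-- The fibre through `x` of the polynomial map with components `F`. -/
def fiber {ι k K : Type*} [CommSemiring k] [CommSemiring K] [Algebra k K]
    (F : Set (MvPolynomial ι k)) (x : ι → K) : Set (ι → K) :=
  {y | ∀ f ∈ F, aeval y f = aeval x f}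

theorem fiber_anti {ι k K : Type*} [CommSemiring k] [CommSemiring K] [Algebra k K]
    {s F : Set (MvPolynomial ι k)} (h : s ⊆ F) (x : ι → K) : fiber F x ⊆ fiber s x :=
  fun _ hy f hf => hy f (h hf)

theorem finite_image_fiber_of_isAlgebraic {ι k K : Type*} [CommRing k] [CommRing K] [IsDomain K]
    [Algebra k K] {x : ι → K} (hx : AlgebraicIndependent k x) {s : Set (MvPolynomial ι k)}
    {g : MvPolynomial ι k} (hg : IsAlgebraic (Algebra.adjoin k s) g) :
    ((fun y : ι → K => aeval y g) '' fiber s x).Finite := by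
  classical
  obtain ⟨P, hP₀, hP⟩ := hg
  let ev (y : ι → K) : Algebra.adjoin k s →ₐ[k] K := (aeval y).comp (Algebra.adjoin k s).val
  have hev : Function.Injective (ev x) := fun a b h => Subtype.val_injective (hx h)
  have hroots : P.map (ev x : Algebra.adjoin k s →+* K) ≠ 0 :=
    (Polynomial.map_ne_zero_iff hev).2 hP₀
  refine (P.map (ev x : Algebra.adjoin k s →+* K)).roots.toFinset.finite_toSet.subset ?_
  rintro _ ⟨y, hy, rfl⟩
  have hxy : ev x = ev y := AlgHom.adjoin_ext fun f hf => (hy f hf).symm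
  rw [Finset.mem_coe, Multiset.mem_toFinset, Polynomial.mem_roots hroots, Polynomial.IsRoot.def,
    Polynomial.eval_map, hxy]
  have h := Polynomial.hom_eval₂ P (algebraMap (Algebra.adjoin k s) (MvPolynomial ι k))
    (aeval y : MvPolynomial ι k →ₐ[k] K).toRingHom g
  rw [← Polynomial.aeval_def, hP, map_zero] at h
  exact h.symm

theorem eventually_eq_of_mem_finite {X : Type*} [TopologicalSpace X] [T1Space X] {S : Set X}
    (hS : S.Finite) (a : X) : ∀ᶠ r in 𝓝 a, r ∈ S → r = a := by
  have h : (S \ {a})ᶜ ∈ 𝓝 a := hS.sdiff.isClosed.compl_mem_nhds (by simp)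
  filter_upwards [h] with r hr hrS
  by_contra hne
  exact hr ⟨hrS, hne⟩

end Fiber

section Differential

variable {ι k 𝕜 : Type*} [Finite ι] [Field k] [NontriviallyNormedField 𝕜] [Algebra k 𝕜]

theorem hasStrictFDerivAt_aeval (x : ι → 𝕜) (f : MvPolynomial ι k) :
    HasStrictFDerivAt (fun y : ι → 𝕜 => aeval y f)
      (fderiv 𝕜 (fun y : ι → 𝕜 => aeval y f) x) x := by
  have := Fintype.ofFinite ι
  exact (AnalyticAt.aeval_mvPolynomial
    (fun i => (ContinuousLinearMap.proj (R := 𝕜) (φ := fun _ : ι => 𝕜) i).analyticAt x)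
    f).hasStrictFDerivAt

theorem fderiv_aeval_apply_eq_zero_of_isAlgebraic [CharZero k] {x : ι → 𝕜}
    (hx : AlgebraicIndependent k x) {s : Set (MvPolynomial ι k)} {w : ι → 𝕜}
    (hw : ∀ f ∈ s, fderiv 𝕜 (fun y : ι → 𝕜 => aeval y f) x w = 0) {g : MvPolynomial ι k}
    (hg : IsAlgebraic (Algebra.adjoin k s) g) :
    fderiv 𝕜 (fun y : ι → 𝕜 => aeval y g) x w = 0 := by
  have := Fintype.ofFinite ι
  have hdiff (f : MvPolynomial ι k) : DifferentiableAt 𝕜 (fun y : ι → 𝕜 => aeval y f) x :=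
    (hasStrictFDerivAt_aeval x f).differentiableAt
  -- Genericity of `x` makes evaluation at `x` injective, so that `𝕜` is torsion-free here.
  let _ : Module (MvPolynomial ι k) 𝕜 := Module.compHom 𝕜 (aeval x : _ →ₐ[k] 𝕜).toRingHom
  have hsmul (f : MvPolynomial ι k) (r : 𝕜) : f • r = aeval x f * r := rfl
  have : IsScalarTower k (MvPolynomial ι k) 𝕜 :=
    ⟨fun a f r => by rw [hsmul, hsmul, map_smul, smul_mul_assoc]⟩
  have : Module.IsTorsionFree (MvPolynomial ι k) 𝕜 := by
    refine .of_smul_eq_zero fun f r hfr => ?_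
    rw [hsmul, mul_eq_zero] at hfr
    exact hfr.imp_left fun h => hx (by simpa using h)
  let D : Derivation k (MvPolynomial ι k) 𝕜 := .mk'
    { toFun f := fderiv 𝕜 (fun y : ι → 𝕜 => aeval y f) x w
      map_add' f g := by simp only [map_add, fderiv_fun_add (hdiff f) (hdiff g), add_apply]
      map_smul' a f := by
        simp [Algebra.smul_def, fderiv_const_mul (hdiff f)] }
    fun f g => by
      simp only [LinearMap.coe_mk, AddHom.coe_mk, map_mul, fderiv_fun_mul (hdiff f) (hdiff g),
        add_apply, smul_apply, smul_eq_mul, hsmul]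
  have hD : ∀ f ∈ Algebra.adjoin k s, D f = 0 :=
    Derivation.eqOn_adjoin (D1 := D) (D2 := 0) hw
  let D' : Derivation (Algebra.adjoin k s) (MvPolynomial ι k) 𝕜 := .mk'
    { toFun := D
      map_add' := map_add D
      map_smul' a f := by
        rw [Subalgebra.smul_def, smul_eq_mul, D.leibniz, hD a a.2, smul_zero, add_zero]
        rfl }
    D.leibniz
  exact derivation_eq_zero_of_isAlgebraic D' hg

variable [CompleteSpace 𝕜]

theorem map_nhds_aeval_eq [CharZero k] {κ : Type*} {b : κ → MvPolynomial ι k}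
    (hb : IsTranscendenceBasis k b) {x : ι → 𝕜} (hx : AlgebraicIndependent k x) :
    map (fun (y : ι → 𝕜) j => aeval y (b j)) (𝓝 x) = 𝓝 fun j => aeval x (b j) := by
  have := Fintype.ofFinite ι
  have hcard := (IsTranscendenceBasis.mvPolynomial ι k).lift_cardinalMk_eq hb
  have : Finite κ := by
    rw [← Cardinal.mk_lt_aleph0_iff, ← Cardinal.lift_lt_aleph0, ← hcard]
    simp
  have := Fintype.ofFinite κ
  have hcard' : Fintype.card ι = Fintype.card κ := by simpa using hcard
  let T : (ι → 𝕜) →L[𝕜] κ → 𝕜 :=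
    .pi fun j => fderiv 𝕜 (fun y : ι → 𝕜 => aeval y (b j)) x
  have hT : HasStrictFDerivAt (fun (y : ι → 𝕜) j => aeval y (b j)) T x :=
    hasStrictFDerivAt_pi.2 fun j => hasStrictFDerivAt_aeval x (b j)
  have hinj : Function.Injective T := by
    refine (injective_iff_map_eq_zero T).2 fun w hw => funext fun i => ?_
    have hw' : ∀ f ∈ Set.range b, fderiv 𝕜 (fun y : ι → 𝕜 => aeval y f) x w = 0 :=
      Set.forall_mem_range.2 (congrFun hw)
    have h := fderiv_aeval_apply_eq_zero_of_isAlgebraic hx hw' (hb.isAlgebraic.isAlgebraic (X i))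
    simpa [fderiv_apply] using h
  exact hT.map_nhds_eq_of_surj <| LinearMap.range_eq_top.2 <|
    (LinearMap.injective_iff_surjective_of_finrank_eq_finrank
      (f := (T : (ι → 𝕜) →ₗ[𝕜] κ → 𝕜)) (by simp [hcard'])).1 hinj

theorem frequently_mem_fiber_and_aeval_ne [CharZero k] {x : ι → 𝕜}
    (hx : AlgebraicIndependent k x) {s : Set (MvPolynomial ι k)} {g : MvPolynomial ι k}
    (hgs : g ∉ s) (hs : AlgebraicIndepOn k id (insert g s)) :
    ∃ᶠ y in 𝓝 x, y ∈ fiber s x ∧ aeval y g ≠ aeval x g := by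
  classical
  obtain ⟨B, hsB, hB⟩ := exists_isTranscendenceBasis_superset hs
  have hgB : g ∈ B := hsB (Set.mem_insert g s)
  let T (y : ι → 𝕜) (b : B) : 𝕜 := aeval y b.1
  let γ (r : 𝕜) : B → 𝕜 := Function.update (T x) ⟨g, hgB⟩ r
  have hγ : Tendsto γ (𝓝[≠] aeval x g) (map T (𝓝 x)) := by
    rw [map_nhds_aeval_eq hB hx]
    have hγ' : Continuous γ := by fun_prop
    simpa [γ, T] using (hγ'.tendsto (aeval x g)).mono_left nhdsWithin_le_nhds
  rw [Filter.frequently_iff]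
  intro U hU
  obtain ⟨r, ⟨y, hyU, hy⟩, hr⟩ :=
    ((hγ.eventually (image_mem_map hU)).and self_mem_nhdsWithin).exists
  refine ⟨y, hyU, fun f hf => ?_, fun h => hr ?_⟩
  · have hfg : (⟨f, hsB (Set.mem_insert_of_mem g hf)⟩ : B) ≠ ⟨g, hgB⟩ :=
      fun h => hgs (by rwa [← Subtype.mk.inj h])
    simpa [γ, T, hfg] using congrFun hy ⟨f, hsB (Set.mem_insert_of_mem g hf)⟩
  · have : aeval y g = r := by simpa [γ, T] using congrFun hy ⟨g, hgB⟩
    exact this.symm.trans h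

theorem finite_image_fiber_of_eventually_eq [CharZero k] {x : ι → 𝕜}
    (hx : AlgebraicIndependent k x) {F : Set (MvPolynomial ι k)} (hF : F.Finite)
    {g : MvPolynomial ι k} (hg : ∀ᶠ y in 𝓝 x, y ∈ fiber F x → aeval y g = aeval x g) :
    ((fun y : ι → 𝕜 => aeval y g) '' fiber F x).Finite := by
  obtain ⟨s, hs⟩ := (AlgebraicIndependent.matroid k (MvPolynomial ι k)).exists_isBasis F
  rw [AlgebraicIndependent.matroid_isBasis_iff] at hs
  obtain ⟨hsi, hsF, hFs⟩ := hs
  have hfiber : ∀ᶠ y in 𝓝 x, y ∈ fiber s x → y ∈ fiber F x := by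
    have h : ∀ f ∈ F, ∀ᶠ y in 𝓝 x, y ∈ fiber s x → aeval y f = aeval x f := fun f hf => by
      have hfin := finite_image_fiber_of_isAlgebraic hx (hFs f hf)
      filter_upwards [(hasStrictFDerivAt_aeval x f).continuousAt.eventually
        (eventually_eq_of_mem_finite hfin _)] with y hy hys
      exact hy ⟨y, hys, rfl⟩
    filter_upwards [(eventually_all_finite hF).2 h] with y hy hys f hf using hy f hf hys
  have hgalg : IsAlgebraic (Algebra.adjoin k s) g := by
    by_contra hgs
    have hgmem : g ∉ s := fun h =>
      hgs (isAlgebraic_algebraMap (⟨g, Algebra.subset_adjoin h⟩ : Algebra.adjoin k s))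
    have hins : AlgebraicIndepOn k id (insert g s) :=
      (AlgebraicIndepOn.insert_iff hgmem).2 ⟨hsi, by rwa [Set.image_id]⟩
    obtain ⟨y, ⟨hys, hyg⟩, hyF, hy⟩ :=
      ((frequently_mem_fiber_and_aeval_ne hx hgmem hins).and_eventually (hfiber.and hg)).exists
    exact hyg (hy (hyF hys))
  exact (finite_image_fiber_of_isAlgebraic hx hgalg).subset (Set.image_mono (fiber_anti hsF x))

end Differential

section Density

variable {ι k 𝕜 : Type*} [Field k] [Countable k] [NontriviallyNormedField 𝕜] [CompleteSpace 𝕜]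
  [Algebra k 𝕜]

theorem dense_transcendental_adjoin {s : Set 𝕜} (hs : s.Countable) :
    Dense {r : 𝕜 | Transcendental (Algebra.adjoin k s) r} := by
  have : Countable (Algebra.adjoin k s) := by
    rw [← Cardinal.mk_le_aleph0_iff, ← Cardinal.lift_le_aleph0]
    exact (Algebra.lift_cardinalMk_adjoin_le k s).trans (by simp [hs.to_subtype])
  exact (Algebraic.countable (Algebra.adjoin k s) 𝕜).dense_compl 𝕜

theorem frequently_algebraicIndependent [Finite ι] {x : ι → 𝕜} {S : Set ι}
    (hS : AlgebraicIndepOn k x S) :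
    ∃ᶠ y in 𝓝 x, AlgebraicIndependent k y ∧ Set.EqOn y x S := by
  classical
  have key (t : Set ι) (ht : t.Finite) :
      ∃ᶠ y in 𝓝 x, AlgebraicIndepOn k y (S ∪ t) ∧ Set.EqOn y x S := by
    induction t, ht using Set.Finite.induction_on with
    | empty =>
      have hx : AlgebraicIndepOn k x (S ∪ ∅) ∧ Set.EqOn x x S :=
        ⟨by rwa [Set.union_empty], Set.eqOn_refl x S⟩
      exact Frequently.filter_mono (frequently_pure.2 hx) (pure_le_nhds x)
    | @insert a t _ _ ih =>
      by_cases ha : a ∈ S ∪ t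
      · simpa only [Set.union_insert, Set.insert_eq_of_mem ha] using ih
      rw [← frequently_frequently_nhds]
      refine ih.mono fun y ⟨hy, hyS⟩ => ?_
      have htr := mem_closure_iff_frequently.1 <| dense_transcendental_adjoin (k := k)
        ((Set.toFinite (S ∪ t)).image y).countable (y a)
      have hupdate : Tendsto (Function.update y a) (𝓝 (y a)) (𝓝 y) := by
        have h : Continuous (Function.update y a) := by fun_prop
        simpa using h.tendsto (y a)
      refine hupdate.frequently (htr.mono fun r hr => ?_)
      have heq : Set.EqOn (Function.update y a r) y (S ∪ t) := fun i hi =>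
        Function.update_of_ne (ne_of_mem_of_not_mem hi ha) r y
      refine ⟨?_, (heq.mono Set.subset_union_left).trans hyS⟩
      rw [Set.union_insert, AlgebraicIndepOn.insert_iff ha, Set.image_congr heq,
        Function.update_self]
      refine ⟨?_, hr⟩
      have hrestrict : (fun i : ↥(S ∪ t) => Function.update y a r i) = fun i : ↥(S ∪ t) => y i :=
        funext fun i => heq i.2
      rwa [AlgebraicIndepOn, hrestrict]
  simpa only [Set.union_univ, AlgebraicIndepOn.univ] using key Set.univ Set.finite_univ

end Density

section Realization

variable {V W : Type*} {d : ℕ} {G : SimpleGraph V} {p : V → EuclideanSpace ℝ (Fin d)}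

/-- The realization with prescribed vertex coordinates. -/
def ofCoords (c : V × Fin d → ℝ) : V → EuclideanSpace ℝ (Fin d) :=
  fun v => WithLp.toLp 2 fun k => c (v, k)

theorem continuous_ofCoords : Continuous (ofCoords : (V × Fin d → ℝ) → _) := by
  unfold ofCoords
  fun_prop

theorem tendsto_ofCoords (p : V → EuclideanSpace ℝ (Fin d)) :
    Tendsto ofCoords (𝓝 fun i : V × Fin d => p i.1 i.2) (𝓝 p) :=
  continuous_ofCoords.tendsto _

/-- The squared distance between the vertices `x` and `y`, as a polynomial in the coordinates. -/
noncomputable def sqDist (d : ℕ) (x y : V) : MvPolynomial (V × Fin d) ℚ :=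
  ∑ k, (X (x, k) - X (y, k)) ^ 2

theorem aeval_sqDist (c : V × Fin d → ℝ) (x y : V) :
    aeval c (sqDist d x y) = ‖ofCoords c x - ofCoords c y‖ ^ 2 := by
  simp [sqDist, ofCoords, EuclideanSpace.norm_sq_eq]

theorem aeval_sqDist_eq_iff {c c' : V × Fin d → ℝ} {x y : V} :
    aeval c (sqDist d x y) = aeval c' (sqDist d x y) ↔
      ‖ofCoords c x - ofCoords c y‖ = ‖ofCoords c' x - ofCoords c' y‖ := by
  rw [aeval_sqDist, aeval_sqDist, sq_eq_sq₀ (norm_nonneg _) (norm_nonneg _)]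

theorem RigidFramework.eventually_congruent [Finite V] (h : RigidFramework G p) :
    ∀ᶠ q in 𝓝 p, Equivalent G p q → Congruent p q := by
  obtain ⟨ε, hε, hrig⟩ := h
  have hnear : ∀ᶠ q in 𝓝 p, ∀ x, ‖p x - q x‖ < ε := eventually_all.2 fun x => by
    have hc : Continuous fun q : V → EuclideanSpace ℝ (Fin d) => ‖p x - q x‖ := by fun_prop
    exact hc.continuousAt.eventually_lt continuousAt_const (by simpa using hε)
  filter_upwards [hnear] with q hq hpq using hrig q hpq hq

theorem RigidFramework.finite_distances [Finite V] (h : RigidFramework G p) (hp : Generic p)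
    (x y : V) : ((fun q => ‖q x - q y‖) '' {q | Equivalent G p q}).Finite := by
  let coords (q : V → EuclideanSpace ℝ (Fin d)) (i : V × Fin d) : ℝ := q i.1 i.2
  let F : Set (MvPolynomial (V × Fin d) ℚ) := {f | ∃ a b, G.Adj a b ∧ sqDist d a b = f}
  have hF : F.Finite := (Set.finite_range fun e : V × V => sqDist d e.1 e.2).subset <| by
    rintro f ⟨a, b, -, rfl⟩
    exact ⟨(a, b), rfl⟩
  have hfiber (c : V × Fin d → ℝ) : c ∈ fiber F (coords p) ↔ Equivalent G p (ofCoords c) := by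
    refine ⟨fun hc a b hab => (aeval_sqDist_eq_iff.1 (hc _ ⟨a, b, hab, rfl⟩)).symm, ?_⟩
    rintro hc f ⟨a, b, hab, rfl⟩
    exact aeval_sqDist_eq_iff.2 (hc a b hab).symm
  have hloc : ∀ᶠ c in 𝓝 (coords p), c ∈ fiber F (coords p) →
      aeval c (sqDist d x y) = aeval (coords p) (sqDist d x y) := by
    filter_upwards [(tendsto_ofCoords p).eventually h.eventually_congruent] with c hc hcF
    exact aeval_sqDist_eq_iff.2 (hc ((hfiber c).1 hcF) x y).symm
  refine ((finite_image_fiber_of_eventually_eq hp hF hloc).image Real.sqrt).subset ?_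
  rintro _ ⟨q, hq, rfl⟩
  exact ⟨_, ⟨coords q, (hfiber _).2 hq, rfl⟩,
    (congrArg Real.sqrt (aeval_sqDist _ x y)).trans (Real.sqrt_sq (norm_nonneg _))⟩

theorem Generic.comp (hp : Generic p) {f : W → V} (hf : f.Injective) : Generic (p ∘ f) :=
  AlgebraicIndependent.comp hp (Prod.map f id) (hf.prodMap Function.injective_id)

theorem frequently_generic [Finite V] {S : Set V} (hS : Generic fun x : S => p x) :
    ∃ᶠ q in 𝓝 p, Generic q ∧ Set.EqOn q p S := by
  let e (i : {i : V × Fin d | i.1 ∈ S}) : S × Fin d := (⟨i.1.1, i.2⟩, i.1.2)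
  have he : e.Injective := fun i j hij => by
    simp only [e, Prod.mk.injEq, Subtype.mk.injEq] at hij
    exact Subtype.ext (Prod.ext hij.1 hij.2)
  have hS' : AlgebraicIndepOn ℚ (fun i : V × Fin d => p i.1 i.2) {i | i.1 ∈ S} :=
    AlgebraicIndependent.comp hS e he
  refine (tendsto_ofCoords p).frequently ((frequently_algebraicIndependent hS').mono ?_)
  rintro c ⟨hc, hcS⟩
  exact ⟨hc, fun x hx => PiLp.ext fun k => hcS (x := (x, k)) hx⟩

end Realization

section Congruence

variable {E : Type*} [NormedAddCommGroup E] [InnerProductSpace ℝ E]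

theorem norm_sub_lineMap_sq (x y z : E) (t : ℝ) :
    ‖x - AffineMap.lineMap y z t‖ ^ 2 =
      (1 - t) * ‖x - y‖ ^ 2 + t * ‖x - z‖ ^ 2 - t * (1 - t) * ‖y - z‖ ^ 2 := by
  have h₁ : x - AffineMap.lineMap y z t = (1 - t) • (x - y) + t • (x - z) := by
    rw [AffineMap.lineMap_apply_module]
    module
  have h₂ := norm_sub_sq_real (x - y) (x - z)
  rw [sub_sub_sub_cancel_left, norm_sub_rev] at h₂
  rw [h₁, h₂, norm_add_sq_real, norm_smul, norm_smul, mul_pow, mul_pow, Real.norm_eq_abs,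
    Real.norm_eq_abs, sq_abs, sq_abs, real_inner_smul_left, real_inner_smul_right]
  ring

theorem inner_sub_sub_eq_of_norm_sub_eq {x y z x' y' z' : E} (hxy : ‖x - y‖ = ‖x' - y'‖)
    (hxz : ‖x - z‖ = ‖x' - z'‖) (hyz : ‖y - z‖ = ‖y' - z'‖) :
    inner ℝ (x - z) (y - z) = inner ℝ (x' - z') (y' - z') := by
  rw [real_inner_eq_norm_mul_self_add_norm_mul_self_sub_norm_sub_mul_self_div_two,
    real_inner_eq_norm_mul_self_add_norm_mul_self_sub_norm_sub_mul_self_div_two,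
    sub_sub_sub_cancel_right, sub_sub_sub_cancel_right, hxy, hxz, hyz]

theorem exists_linearIsometry_comp_eq [FiniteDimensional ℝ E] {M : Type*} [AddCommGroup M]
    [Module ℝ M] {A B : M →ₗ[ℝ] E} (h : ∀ a, ‖A a‖ = ‖B a‖) :
    ∃ L : E →ₗᵢ[ℝ] E, ∀ a, L (A a) = B a := by
  obtain ⟨r, hr⟩ := A.rangeRestrict.exists_rightInverse_of_surjective A.range_rangeRestrict
  have hAr (s : A.range) : A (r s) = s := congrArg Subtype.val (LinearMap.congr_fun hr s)
  let L : A.range →ₗᵢ[ℝ] E := ⟨B ∘ₗ r, fun s => by simp [← h, hAr]⟩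
  refine ⟨L.extend, fun a => ?_⟩
  have hA : A (r (A.rangeRestrict a)) = A a := hAr (A.rangeRestrict a)
  have hB : ‖B (r (A.rangeRestrict a)) - B a‖ = 0 := by
    rw [← map_sub, ← h, map_sub, hA, sub_self, norm_zero]
  exact (L.extend_apply (A.rangeRestrict a)).trans (sub_eq_zero.1 (norm_eq_zero.1 hB))

theorem exists_linearIsometry_of_inner_eq [FiniteDimensional ℝ E] {N : Type*} {p q : N → E}
    (h : ∀ x y, inner ℝ (p x) (p y) = inner ℝ (q x) (q y)) :
    ∃ L : E →ₗᵢ[ℝ] E, ∀ x, L (p x) = q x := by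
  have hnorm (a : N →₀ ℝ) :
      ‖Finsupp.linearCombination ℝ p a‖ = ‖Finsupp.linearCombination ℝ q a‖ := by
    rw [← sq_eq_sq₀ (norm_nonneg _) (norm_nonneg _), ← real_inner_self_eq_norm_sq,
      ← real_inner_self_eq_norm_sq]
    simp only [Finsupp.linearCombination_apply, Finsupp.sum, sum_inner, inner_sum, inner_smul_left,
      inner_smul_right, h]
  obtain ⟨L, hL⟩ := exists_linearIsometry_comp_eq hnorm
  exact ⟨L, fun x => by simpa using hL (Finsupp.single x 1)⟩

theorem exists_isometry_of_norm_sub_eq [FiniteDimensional ℝ E] {N : Type*} {p q : N → E}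
    (h : ∀ x y, ‖p x - p y‖ = ‖q x - q y‖) : ∃ f : E → E, Isometry f ∧ ∀ x, f (p x) = q x := by
  rcases isEmpty_or_nonempty N with hN | ⟨⟨z⟩⟩
  · exact ⟨id, isometry_id, hN.elim⟩
  obtain ⟨L, hL⟩ := exists_linearIsometry_of_inner_eq fun x y =>
    inner_sub_sub_eq_of_norm_sub_eq (h x y) (h x z) (h y z)
  refine ⟨fun a => L (a - p z) + q z, Isometry.of_dist_eq fun a b => ?_, fun x => ?_⟩
  · simp [dist_eq_norm, ← map_sub]
  · simp [hL x]

end Congruence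

section Star

variable {E N : Type*} [Finite N]

theorem eventually_norm_sub_eq_of_star [SeminormedAddCommGroup E] {Q : Set (N → E)}
    (hQ : ∀ x y, ((fun q => ‖q x - q y‖) '' Q).Finite) (p : N → E) (y : N) :
    ∀ᶠ z in 𝓝 (p y), ∀ q ∈ Q, ∀ z', (∀ x, ‖p x - z‖ = ‖q x - z'‖) →
      ∀ x, ‖p x - p y‖ = ‖q x - q y‖ := by
  have hnear (x : N) : ∀ᶠ z in 𝓝 (p y), ∀ r ∈ (fun q => ‖q x - q y‖) '' Q,
      |r - ‖p x - p y‖| ≤ 2 * ‖p y - z‖ → r = ‖p x - p y‖ := by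
    obtain ⟨δ, hδ, hball⟩ :=
      Metric.eventually_nhds_iff.1 (eventually_eq_of_mem_finite (hQ x y) ‖p x - p y‖)
    have hz : ∀ᶠ z in 𝓝 (p y), 2 * ‖p y - z‖ < δ := by
      have hc : Continuous fun z => 2 * ‖p y - z‖ := by fun_prop
      exact hc.continuousAt.eventually_lt continuousAt_const (by simpa using hδ)
    filter_upwards [hz] with z hz r hr hrz using hball (hrz.trans_lt hz) hr
  filter_upwards [eventually_all.2 hnear] with z hz q hq z' hqz x
  refine (hz x _ ⟨q, hq, rfl⟩ ?_).symm
  have h₁ := abs_norm_sub_norm_le (q x - q y) (q x - z')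
  have h₂ := abs_norm_sub_norm_le (p x - z) (p x - p y)
  rw [sub_sub_sub_cancel_left, norm_sub_rev z', ← hqz, ← hqz] at h₁
  rw [sub_sub_sub_cancel_left] at h₂
  linarith [abs_sub_le ‖q x - q y‖ ‖p x - z‖ ‖p x - p y‖]

/- Once the distances from `y` are known, Stewart's theorem lets the star at `z` determine the star
at every other point of the line through `p y` and `z`. A good centre for `t` may therefore be moved
close to `p y` by a homothety with centre `p y`. -/
theorem exists_eventually_norm_sub_eq_of_star [NormedAddCommGroup E] [InnerProductSpace ℝ E]
    {Q : Set (N → E)} (hQ : ∀ x y, ((fun q => ‖q x - q y‖) '' Q).Finite) (p : N → E)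
    {t : Set N} (ht : t.Finite) :
    ∃ c, ∀ᶠ z in 𝓝 c, ∀ q ∈ Q, ∀ z', (∀ x, ‖p x - z‖ = ‖q x - z'‖) →
      ∀ y ∈ t, ∀ x, ‖p x - p y‖ = ‖q x - q y‖ := by
  induction t, ht using Set.Finite.induction_on with
  | empty => exact ⟨0, by simp⟩
  | @insert y t _ _ ih =>
    obtain ⟨c, hc⟩ := ih
    have hline : Tendsto (AffineMap.lineMap (p y) c : ℝ → E) (𝓝[≠] 0) (𝓝 (p y)) := by
      have h : Continuous (AffineMap.lineMap (p y) c : ℝ → E) := AffineMap.lineMap_continuous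
      simpa using (h.tendsto 0).mono_left nhdsWithin_le_nhds
    obtain ⟨r, hr, hr₀⟩ := ((hline.eventually
      (eventually_eventually_nhds.2 (eventually_norm_sub_eq_of_star hQ p y))).and
      self_mem_nhdsWithin).exists
    have hhom : Tendsto (fun z => AffineMap.lineMap (p y) z r⁻¹)
        (𝓝 (AffineMap.lineMap (p y) c r)) (𝓝 c) := by
      have h : Continuous fun z : E => AffineMap.lineMap (p y) z r⁻¹ := by
        simp only [AffineMap.lineMap_apply_module]
        fun_prop
      simpa [AffineMap.lineMap_lineMap_right, inv_mul_cancel₀ hr₀] using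
        h.tendsto (AffineMap.lineMap (p y) c r)
    refine ⟨AffineMap.lineMap (p y) c r, ?_⟩
    filter_upwards [hr, hhom.eventually hc] with z hzy hzt q hq z' hqz
    have hy := hzy q hq z' hqz
    refine Set.forall_mem_insert.2 ⟨hy, hzt q hq (AffineMap.lineMap (q y) z' r⁻¹) fun x => ?_⟩
    rw [← sq_eq_sq₀ (norm_nonneg _) (norm_nonneg _), norm_sub_lineMap_sq, norm_sub_lineMap_sq,
      hy x, hqz x, hqz y]

end Star

section Contraction

variable {V : Type*} {d : ℕ} {G : SimpleGraph V} {S X : Set V} {u v : V}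

theorem toContract_eq_iff {x y : V} :
    toContract S x = toContract S y ↔ x = y ∨ (x ∈ S ∧ y ∈ S) :=
  Quotient.eq (r := contractSetoid S)

theorem toContract_injOn : Set.InjOn (toContract S) Sᶜ := fun _ hx _ _ h =>
  (toContract_eq_iff.1 h).elim id fun h => absurd h.1 hx

theorem toContract_ne {x y : V} (hx : x ∉ S) (hxy : x ≠ y) : toContract S x ≠ toContract S y :=
  fun h => (toContract_eq_iff.1 h).elim hxy fun h => hx h.1

theorem out_toContract {x : V} (hx : x ∉ S) : (toContract S x).out = x :=
  (toContract_eq_iff.1 (Quotient.out_eq (toContract S x))).elim id fun h => absurd h.2 hx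

theorem contract_adj_iff {a b : ContractVertex S} : (contract G S).Adj a b ↔
    a ≠ b ∧ ∃ x y, G.Adj x y ∧ toContract S x = a ∧ toContract S y = b :=
  Iff.rfl

theorem contract_adj_toContract {x y : V} (h : G.Adj x y) (hx : x ∉ S) :
    (contract G S).Adj (toContract S x) (toContract S y) :=
  contract_adj_iff.2 ⟨toContract_ne hx h.ne, x, y, h, rfl, rfl⟩

/-- The vertices outside `S` with a neighbour in `S`. -/
def outerBoundary (G : SimpleGraph V) (S : Set V) : Set V :=
  {x | x ∉ S ∧ ∃ y ∈ S, G.Adj x y}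

theorem IsComponentOfDelete.nonempty (h : IsComponentOfDelete G X S) : S.Nonempty := by
  obtain ⟨C, rfl⟩ := h
  exact C.nonempty_supp.image _

theorem IsComponentOfDelete.disjoint (h : IsComponentOfDelete G X S) : Disjoint X S := by
  obtain ⟨C, rfl⟩ := h
  exact Set.disjoint_left.2 fun _ hx ⟨a, _, ha⟩ => a.2 (ha ▸ hx)

theorem IsComponentOfDelete.mem_of_adj (h : IsComponentOfDelete G X S) {x y : V} (hx : x ∈ S)
    (hy : y ∉ X) (hxy : G.Adj x y) : y ∈ S := by
  obtain ⟨C, rfl⟩ := h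
  obtain ⟨a, ha, rfl⟩ := hx
  have hay : (G.induce Xᶜ).Adj a ⟨y, hy⟩ := hxy
  exact ⟨⟨y, hy⟩, (C.mem_supp_congr_adj hay).1 ha, rfl⟩

theorem IsComponentOfDelete.outerBoundary_subset (h : IsComponentOfDelete G X S) :
    outerBoundary G S ⊆ X := fun _ ⟨hx, _, hy, hxy⟩ =>
  by_contra fun hxX => hx (h.mem_of_adj hy hxX hxy.symm)

theorem IsComponentOfDelete.eq_of_forall_adj (h : IsComponentOfDelete G X S) {α : Type*}
    {f : V → α} (hf : ∀ x ∈ S, ∀ y ∈ S, G.Adj x y → f x = f y) {x y : V} (hx : x ∈ S)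
    (hy : y ∈ S) : f x = f y := by
  obtain ⟨C, rfl⟩ := h
  obtain ⟨a, ha, rfl⟩ := hx
  obtain ⟨b, hb, rfl⟩ := hy
  obtain ⟨w⟩ := C.reachable_of_mem_supp ha hb
  induction w with
  | nil => rfl
  | @cons a c b hac _ ih =>
    have hc : c ∈ C.supp := (C.mem_supp_congr_adj hac).1 ha
    exact (hf _ ⟨a, ha, rfl⟩ _ ⟨c, hc, rfl⟩ hac).trans (ih hc hb)

theorem Generic.frequently_contract [Finite V] {p : V → EuclideanSpace ℝ (Fin d)} (hp : Generic p)
    {w : V} (hw : w ∈ S) (c : EuclideanSpace ℝ (Fin d)) :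
    ∃ᶠ z in 𝓝 c, ∃ P : ContractVertex S → EuclideanSpace ℝ (Fin d),
      Generic P ∧ (∀ x ∉ S, P (toContract S x) = p x) ∧ P (toContract S w) = z := by
  classical
  let P₀ : ContractVertex S → EuclideanSpace ℝ (Fin d) :=
    Function.update (fun a => p a.out) (toContract S w) c
  have hP₀ : Generic fun a : ↥({toContract S w}ᶜ : Set (ContractVertex S)) => P₀ a := by
    have h : (fun a : ↥({toContract S w}ᶜ : Set (ContractVertex S)) => P₀ a) =
        p ∘ fun a => a.1.out := funext fun a => Function.update_of_ne a.2 _ _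
    exact h ▸ hp.comp (Quotient.out_injective.comp Subtype.val_injective)
  have heval : Tendsto (fun P : ContractVertex S → EuclideanSpace ℝ (Fin d) => P (toContract S w))
      (𝓝 P₀) (𝓝 c) := by
    simpa [P₀] using (continuous_apply (toContract S w)).tendsto P₀
  refine heval.frequently ((frequently_generic hP₀).mono ?_)
  rintro P ⟨hP, hPP₀⟩
  refine ⟨P, hP, fun x hx => ?_, rfl⟩
  have hne : toContract S x ≠ toContract S w := toContract_ne hx (ne_of_mem_of_not_mem hw hx).symm
  exact (hPP₀ hne).trans <| (Function.update_of_ne hne _ _).trans (congrArg p (out_toContract hx))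

theorem GloballyLinked.contract_of_norm_sub_eq {p : V → EuclideanSpace ℝ (Fin d)}
    {P : ContractVertex S → EuclideanSpace ℝ (Fin d)} (hlink : GloballyLinked G p u v)
    (hu : u ∉ S) (hv : v ∉ S) (hP : ∀ x ∉ S, P (toContract S x) = p x)
    (hboundary : ∀ q, Equivalent (contract G S) P q →
      ∀ x ∈ outerBoundary G S, ∀ y ∈ outerBoundary G S,
        ‖p x - p y‖ = ‖q (toContract S x) - q (toContract S y)‖) :
    GloballyLinked (contract G S) P (toContract S u) (toContract S v) := by
  classical
  intro q hq
  obtain ⟨f, hf, hfq⟩ := exists_isometry_of_norm_sub_eq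
    (p := fun x : outerBoundary G S => p x) (q := fun x => q (toContract S x))
    fun x y => hboundary q hq x x.2 y y.2
  let q' (x : V) : EuclideanSpace ℝ (Fin d) := if x ∈ S then f (p x) else q (toContract S x)
  have hq'S {x : V} (hx : x ∈ S) : q' x = f (p x) := if_pos hx
  have hq'q {x : V} (hx : x ∉ S) : q' x = q (toContract S x) := if_neg hx
  have hf' (x y : V) : ‖p x - p y‖ = ‖f (p x) - f (p y)‖ := by
    rw [← dist_eq_norm, ← dist_eq_norm, hf.dist_eq]
  have hmixed {x y : V} (hxy : G.Adj x y) (hx : x ∉ S) (hy : y ∈ S) :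
      ‖p x - p y‖ = ‖q' x - q' y‖ := by
    rw [hf', hq'S hy, hq'q hx, ← hfq ⟨x, hx, y, hy, hxy⟩]
  have hq' : Equivalent G p q' := fun x y hxy => by
    by_cases hx : x ∈ S <;> by_cases hy : y ∈ S
    · rw [hq'S hx, hq'S hy, hf']
    · rw [norm_sub_rev, norm_sub_rev (q' x), hmixed hxy.symm hy hx]
    · exact hmixed hxy hx hy
    · rw [hq'q hx, hq'q hy, ← hq _ _ (contract_adj_toContract hxy hx), hP x hx, hP y hy]
  rw [hP u hu, hP v hv, hlink q' hq', hq'q hu, hq'q hv]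

theorem WeaklyGloballyLinked.contract [Finite V] (hX : PairRigid d G u v X)
    (hS : IsComponentOfDelete G X S) (h : WeaklyGloballyLinked d G u v) :
    WeaklyGloballyLinked d (contract G S) (toContract S u) (toContract S v) := by
  obtain ⟨p, hp, hlink⟩ := h
  obtain ⟨hrig, hu, hv⟩ := hX
  obtain ⟨w, hw⟩ := hS.nonempty
  have hXS {x : V} (hx : x ∈ X) : x ∉ S := hS.disjoint.notMem_of_mem_left hx
  let restrict (q : X → EuclideanSpace ℝ (Fin d)) (x : outerBoundary G S) :=
    q ⟨x, hS.outerBoundary_subset x.2⟩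
  have hpX : Generic fun x : X => p x := hp.comp Subtype.val_injective
  obtain ⟨c, hc⟩ := exists_eventually_norm_sub_eq_of_star
    (Q := restrict '' {q | Equivalent (G.induce X) (fun x : X => p x) q})
    (fun x y => by
      rw [Set.image_image]
      exact (hrig _ hpX).finite_distances hpX _ _)
    (fun x => p x) Set.finite_univ
  obtain ⟨_, ⟨P, hP, hPp, rfl⟩, hstar⟩ := ((hp.frequently_contract hw c).and_eventually hc).exists
  refine ⟨P, hP, hlink.contract_of_norm_sub_eq (hXS hu) (hXS hv) hPp fun q hq x hx y hy => ?_⟩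
  refine hstar _ ⟨fun x => q (toContract S x), fun a b hab => ?_, rfl⟩ (q (toContract S w)) ?_
    ⟨y, hy⟩ trivial ⟨x, hx⟩
  · change ‖p a - p b‖ = ‖q (toContract S a) - q (toContract S b)‖
    rw [← hPp a (hXS a.2), ← hPp b (hXS b.2)]
    exact hq _ _ (contract_adj_toContract hab (hXS a.2))
  · rintro ⟨a, ha, b, hb, hab⟩
    rw [← hPp a ha, ← toContract_eq_iff.2 (.inr ⟨hb, hw⟩)]
    exact hq _ _ (contract_adj_toContract hab ha)

end Contraction

section Limit

variable {V α : Type*} {d : ℕ} {G : SimpleGraph V} {p : V → EuclideanSpace ℝ (Fin d)}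
  {𝒰 : Ultrafilter α} {P Q : α → V → EuclideanSpace ℝ (Fin d)} {u v : V}

theorem tendsto_norm_sub_of_adj (hP : Tendsto P 𝒰 (𝓝 p))
    (hPQ : ∀ᶠ a in 𝒰, Equivalent G (P a) (Q a)) {x y : V} (hxy : G.Adj x y) :
    Tendsto (fun a => ‖Q a x - Q a y‖) 𝒰 (𝓝 ‖p x - p y‖) := by
  rw [tendsto_pi_nhds] at hP
  exact ((hP x).sub (hP y)).norm.congr' (hPQ.mono fun a ha => ha x y hxy)

theorem exists_tendsto_sub_of_reachable (hP : Tendsto P 𝒰 (𝓝 p))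
    (hPQ : ∀ᶠ a in 𝒰, Equivalent G (P a) (Q a)) {x y : V} (hxy : G.Reachable x y) :
    ∃ e, Tendsto (fun a => Q a x - Q a y) 𝒰 (𝓝 e) := by
  obtain ⟨w⟩ := hxy
  induction w with
  | nil => exact ⟨0, by simp⟩
  | @cons x z y hxz _ ih =>
    have hbounded : ∀ᶠ a in 𝒰, Q a x - Q a z ∈ Metric.closedBall 0 (‖p x - p z‖ + 1) := by
      filter_upwards [(tendsto_norm_sub_of_adj hP hPQ hxz).eventually
        (gt_mem_nhds (lt_add_one _))] with a ha using mem_closedBall_zero_iff.2 ha.le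
    obtain ⟨e₁, -, he₁⟩ := (isCompact_closedBall _ _).ultrafilter_le_nhds
      (𝒰.map fun a => Q a x - Q a z) (le_principal_iff.2 hbounded)
    obtain ⟨e₂, he₂⟩ := ih
    exact ⟨e₁ + e₂, by simpa using Tendsto.add he₁ he₂⟩

theorem exists_equivalent_of_tendsto (hP : Tendsto P 𝒰 (𝓝 p))
    (hPQ : ∀ᶠ a in 𝒰, Equivalent G (P a) (Q a)) :
    ∃ q, Equivalent G p q ∧ ∀ x y, G.Reachable x y →
      Tendsto (fun a => ‖Q a x - Q a y‖) 𝒰 (𝓝 ‖q x - q y‖) := by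
  let base (x : V) : V := (G.connectedComponentMk x).out
  have hbase (x : V) : G.Reachable x (base x) :=
    (SimpleGraph.ConnectedComponent.exact (Quot.out_eq (G.connectedComponentMk x))).symm
  choose q hq using fun x => exists_tendsto_sub_of_reachable hP hPQ (hbase x)
  have hlim (x y : V) (hxy : G.Reachable x y) :
      Tendsto (fun a => ‖Q a x - Q a y‖) 𝒰 (𝓝 ‖q x - q y‖) := by
    have hxy' : base x = base y :=
      congrArg Quot.out (SimpleGraph.ConnectedComponent.sound hxy)
    simpa only [hxy', sub_sub_sub_cancel_right] using ((hq x).sub (hq y)).norm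
  exact ⟨q, fun x y hxy => tendsto_nhds_unique (tendsto_norm_sub_of_adj hP hPQ hxy)
    (hlim x y hxy.reachable), hlim⟩

theorem GloballyLinked.eventually_norm_sub_mem (h : GloballyLinked G p u v)
    (huv : G.Reachable u v) {U : Set ℝ} (hU : U ∈ 𝓝 ‖p u - p v‖) :
    ∀ᶠ P in 𝓝 p, ∀ q, Equivalent G P q → ‖q u - q v‖ ∈ U := by
  refine mem_iff_ultrafilter.2 fun 𝒰 h𝒰 => by_contra fun hmem => ?_
  have hbad : ∀ᶠ P : V → EuclideanSpace ℝ (Fin d) in 𝒰, ∃ q, Equivalent G P q ∧ ‖q u - q v‖ ∉ U :=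
    (Ultrafilter.eventually_not.2 hmem).mono fun P hP => by simpa using hP
  obtain ⟨Q, hQ⟩ := hbad.choice
  obtain ⟨q, hpq, hlim⟩ := exists_equivalent_of_tendsto (P := id) h𝒰 (hQ.mono fun _ h => h.1)
  rw [h q hpq] at hU
  obtain ⟨_, ⟨_, hnotMem⟩, hmem'⟩ := (hQ.and ((hlim u v huv).eventually hU)).exists
  exact hnotMem hmem'

theorem GloballyLinked.reachable (hd : 1 ≤ d) (h : GloballyLinked G p u v) :
    G.Reachable u v := by
  classical
  by_contra huv
  have : Nonempty (Fin d) := ⟨⟨0, hd⟩⟩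
  obtain ⟨b, hb⟩ := exists_norm_eq (EuclideanSpace ℝ (Fin d)) (c := ‖p u - p v‖ + 1) (by positivity)
  let q (x : V) : EuclideanSpace ℝ (Fin d) :=
    if G.Reachable u x then p x + (b - (p u - p v)) else p x
  have hq : Equivalent G p q := fun x y hxy => by
    have hiff : G.Reachable u x ↔ G.Reachable u y :=
      ⟨fun h => h.trans hxy.reachable, fun h => h.trans hxy.symm.reachable⟩
    simp only [q, hiff]
    split_ifs
    · rw [add_sub_add_right_eq_sub]
    · rfl
  have hquv : q u - q v = b := by
    simp only [q, huv, SimpleGraph.Reachable.refl, if_true, if_false]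
    abel
  have hnorm := h q hq
  rw [hquv, hb] at hnorm
  linarith

end Limit

section Lift

variable {V : Type*} {d : ℕ} {G : SimpleGraph V} {S X : Set V} {u v : V}

theorem GloballyLinked.comp_toContract (hS : IsComponentOfDelete G X S)
    {P : ContractVertex S → EuclideanSpace ℝ (Fin d)}
    (h : GloballyLinked (Rigidity.contract G S) P (toContract S u) (toContract S v)) :
    GloballyLinked G (P ∘ toContract S) u v := by
  intro q hq
  have hconst {x y : V} (hx : x ∈ S) (hy : y ∈ S) : q x = q y :=
    hS.eq_of_forall_adj (fun a ha b hb hab => by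
      have hlen : 0 = ‖q a - q b‖ := by
        rw [← hq a b hab, Function.comp_apply, Function.comp_apply,
          toContract_eq_iff.2 (.inr ⟨ha, hb⟩), sub_self, norm_zero]
      exact sub_eq_zero.1 (norm_eq_zero.1 hlen.symm)) hx hy
  let q' : ContractVertex S → EuclideanSpace ℝ (Fin d) := Quotient.lift q fun x y hxy =>
    hxy.elim (congrArg q) fun h => hconst h.1 h.2
  refine h q' fun a b hab => ?_
  obtain ⟨-, x, y, hxy, rfl, rfl⟩ := contract_adj_iff.1 hab
  exact hq x y hxy

theorem WeaklyGloballyLinked.of_contract [Finite V] (hd : 1 ≤ d) (hX : PairRigid d G u v X)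
    (hS : IsComponentOfDelete G X S)
    (h : WeaklyGloballyLinked d (Rigidity.contract G S) (toContract S u) (toContract S v)) :
    WeaklyGloballyLinked d G u v := by
  obtain ⟨P, hP, hlink⟩ := h
  obtain ⟨hrig, hu, hv⟩ := hX
  obtain ⟨p, hp⟩ : ∃ p, P ∘ toContract S = p := ⟨_, rfl⟩
  have hlink' : GloballyLinked G p u v := hp ▸ hlink.comp_toContract hS
  have hpS : Generic fun x : ↥Sᶜ => p x := hp ▸ hP.comp toContract_injOn.injective
  have hXS : X ⊆ Sᶜ := hS.disjoint.subset_compl_right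
  have hpX : Generic fun x : X => p x :=
    hpS.comp (f := Set.inclusion hXS) (Set.inclusion_injective hXS)
  have hfin := (hrig _ hpX).finite_distances hpX ⟨u, hu⟩ ⟨v, hv⟩
  have hU := eventually_eq_of_mem_finite hfin ‖p u - p v‖
  obtain ⟨p', ⟨hp', hp'p⟩, hclose⟩ := ((frequently_generic hpS).and_eventually
    (hlink'.eventually_norm_sub_mem (hlink'.reachable hd) hU)).exists
  refine ⟨p', hp', fun q hq => ?_⟩
  have hqX : Equivalent (G.induce X) (fun x : X => p x) fun x => q x := fun a b hab => by
    change ‖p a - p b‖ = ‖q a - q b‖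
    rw [← hp'p (hXS a.2), ← hp'p (hXS b.2)]
    exact hq a b hab
  rw [hp'p (hXS hu), hp'p (hXS hv)]
  exact (hclose q hq ⟨_, hqX, rfl⟩).symm

end Lift

end Rigidity

theorem mainTheorem6 {V : Type*} [Finite V] (d : ℕ) (hd : 1 ≤ d) (G : SimpleGraph V) (u v : V)
    (V₀ V₁ : Set V) (hV₀ : Rigidity.PairRigid d G u v V₀)
    (hV₁ : Rigidity.IsComponentOfDelete G V₀ V₁) :
    Rigidity.WeaklyGloballyLinked d G u v ↔
      Rigidity.WeaklyGloballyLinked d (Rigidity.contract G V₁)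
        (Rigidity.toContract V₁ u) (Rigidity.toContract V₁ v) :=
  ⟨Rigidity.WeaklyGloballyLinked.contract hV₀ hV₁,
    Rigidity.WeaklyGloballyLinked.of_contract hd hV₀ hV₁⟩
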